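/- Let $X$ be a real locally convex topological vector space (not necessarily Hausdorff), let $C\subseteq X$ be a nonempty convex set with closure $\overline{C}$, and let $f\colon C\to\overline{C}$ be a sequentially continuous map (that is, $x_n\to x$ in $C$ implies $f(x_n)\to f(x)$) such that $f(C)$ is totally bounded (that is, for every neighbourhood $U$ of $0$ the set $f(C)$ is covered by finitely many translates of $U$). Then $f$ has an approximate fixed point net: there is a net $(x_i)_{i\in I}$ in $C$, indexed by a nonempty directed set $I$, with $x_i-f(x_i)\to 0$; equivalently, $$0\in\overline{\{x-f(x) : x\in C\}}.$$ -/

import Mathlib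

open Filter Topology

universe u

/-- A map `f : C → closure C` has an approximate fixed point net if there is a net `(xᵢ)` in `C`,
indexed by a nonempty directed (preordered) set, such that `xᵢ - f xᵢ → 0`. -/
def HasApproxFixedPointNet {X : Type u} [AddCommGroup X] [TopologicalSpace X]
    {C : Set X} (f : C → closure C) : Prop :=
  ∃ (ι : Type u) (_ : Preorder ι) (_ : IsDirectedOrder ι) (_ : Nonempty ι) (x : ι → C),
    Tendsto (fun i => (x i : X) - (f (x i) : X)) atTop (𝓝 0)

/-!
By local convexity it suffices to make `p (x - f x)` small for a single continuous seminorm `p`.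
Total boundedness of `f(C)`, whose points are limits of points of `C`, yields finitely many
`c j ∈ C` such that every value of `f` is `p`-close to some `c j`. A partition of unity subordinate
to this cover (the Schauder projection) moves the values of `f` by little into the convex hull of
the `c j`. This hull is parametrized by a standard simplex, on which `f` is continuous because
sequential continuity suffices on metrizable spaces, so Brouwer's theorem on the simplex gives
the desired point.

Brouwer's theorem is deduced from Scarf's lemma, which replaces the triangulation of Sperner's lemma
by a finite set of points ordered by each of their coordinates. To find a fixed point of `g`,
colour each point by a coordinate which `g` does not decrease. On a fine net, Scarf's lemma gives a
set of small diameter on which each coordinate occurs as a colour or is nearly zero. In the limit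
this is a point none of whose coordinates is decreased by `g`, and it is fixed since the coordinates
sum to `1`.
-/

section Counting

open Finset

variable {α β : Type*} [DecidableEq α] [DecidableEq β]

theorem card_filter_image_erase_eq_image (s : Finset α) (f : α → β)
    (h : #s = #(s.image f) + 1) :
    #{a ∈ s | (s.erase a).image f = s.image f} = 2 := by
  obtain ⟨a, ha, b, hb, hab, hfab⟩ := exists_ne_map_eq_of_card_lt_of_maps_to
    (by omega : #(s.image f) < #s) fun x hx => mem_image_of_mem f hx
  have injOn_erase : ∀ d ∈ s, (s.erase d).image f = s.image f → Set.InjOn f (s.erase d) := by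
    intro d hd himage
    rw [← card_image_iff, himage, card_erase_of_mem hd]
    omega
  have image_erase : ∀ d e, d ≠ e → e ∈ s → f d = f e → (s.erase d).image f = s.image f := by
    intro d e hde he hf
    refine (image_subset_image (s.erase_subset d)).antisymm
      (image_subset_iff.2 fun x hx => ?_)
    by_cases hxd : x = d
    · rw [hxd, hf]
      exact mem_image_of_mem f (mem_erase.2 ⟨hde.symm, he⟩)
    · exact mem_image_of_mem f (mem_erase.2 ⟨hxd, hx⟩)
  rw [card_eq_two]
  refine ⟨a, b, hab, ext fun d => ?_⟩
  simp only [mem_filter, mem_insert, mem_singleton]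
  constructor
  · rintro ⟨hd, himage⟩
    by_contra! hne
    exact hab (injOn_erase d hd himage (mem_erase.2 ⟨hne.1.symm, ha⟩)
      (mem_erase.2 ⟨hne.2.symm, hb⟩) hfab)
  · rintro (rfl | rfl)
    · exact ⟨ha, image_erase _ b hab hb hfab⟩
    · exact ⟨hb, image_erase _ a hab.symm ha hfab.symm⟩

theorem even_card_filter_image_erase [Fintype β] (c : α → β) (b : β) {P : Finset α}
    (hP : #P = Fintype.card β) (hc : P.image c ≠ univ) :
    Even #{x ∈ P | (P.erase x).image c = univ.erase b} := by
  rcases eq_empty_or_nonempty {x ∈ P | (P.erase x).image c = univ.erase b}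
    with h | ⟨x, hx⟩
  · simp only [h, card_empty, Even.zero]
  have himage : P.image c = univ.erase b := by
    have hsub : univ.erase b ⊆ P.image c :=
      (mem_filter.1 hx).2 ▸ image_subset_image (P.erase_subset x)
    refine (subset_erase.2 ⟨subset_univ _, fun hb => hc ?_⟩).antisymm hsub
    rw [eq_univ_iff_forall]
    intro d
    by_cases hd : d = b
    · exact hd ▸ hb
    · exact hsub (mem_erase.2 ⟨hd, mem_univ d⟩)
  rw [← himage, card_filter_image_erase_eq_image]
  · exact even_two
  · rw [himage, card_erase_add_one (mem_univ b), hP, card_univ]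

variable [Fintype α] (p : Finset α → Prop) [DecidablePred p]

theorem card_filter_covBy_left (Q : Finset α) [DecidablePred (Q ⋖ ·)] :
    #{P | Q ⋖ P ∧ p P} = #{x ∈ Qᶜ | p (insert x Q)} := by
  have himage : ({P | Q ⋖ P ∧ p P} : Finset (Finset α)) =
      {x ∈ Qᶜ | p (insert x Q)}.image (insert · Q) := by
    ext P
    simp only [covBy_iff_exists_insert, mem_image, mem_filter, mem_compl]
    grind
  rw [himage, card_image_of_injOn
    ((insert_inj_on' Q).mono (coe_subset.2 (filter_subset _ _)))]

theorem card_filter_covBy_right (P : Finset α) [DecidablePred (· ⋖ P)] :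
    #{Q | Q ⋖ P ∧ p Q} = #{x ∈ P | p (P.erase x)} := by
  have himage : ({Q | Q ⋖ P ∧ p Q} : Finset (Finset α)) =
      {x ∈ P | p (P.erase x)}.image P.erase := by
    ext Q
    simp only [covBy_iff_exists_erase, mem_image, mem_filter]
    grind
  rw [himage, card_image_of_injOn (P.erase_injOn.mono (coe_subset.2 (filter_subset _ _)))]

end Counting

section Scarf

open Finset

variable {ι α β : Type*} [LinearOrder β]

/-- A finite set `P` is dominant for the weak orders induced by the `v i` if no point lies strictly
above the minimum of `P` in all of these orders simultaneously. Dominant sets play the role of the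
simplices of a triangulation in Sperner's lemma. -/
def IsDominant (v : ι → α → β) (P : Finset α) : Prop :=
  ∀ y, ∃ i, ∀ x ∈ P, v i y ≤ v i x

/-- The point `y` lies strictly above the minimum of `Q` in every order but possibly the `a`-th. -/
def ExceedsExcept (v : ι → α → β) (a : ι) (Q : Finset α) (y : α) : Prop :=
  ∀ i ≠ a, ∃ x ∈ Q, v i x < v i y

/-- Slack points for the orders induced by the `v i`: the `i`-th one is least in the `i`-th order
and lies, in every other order, above all points that are not slack. They stand for the
boundary of the simplex in Sperner's lemma. -/
structure IsSlack (v : ι → α → β) (e : ι → α) : Prop where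
  le : ∀ i y, v i (e i) ≤ v i y
  lt : ∀ i j y, j ≠ i → y ∉ Set.range e → v i y < v i (e j)

variable {v : ι → α → β} {P Q : Finset α} {e : ι → α} {c : α → ι}

theorem IsDominant.anti (hP : IsDominant v P) (hQP : Q ⊆ P) : IsDominant v Q := fun y =>
  (hP y).imp fun _ hi x hx => hi x (hQP hx)

theorem IsDominant.le_of_exceedsExcept (hQ : IsDominant v Q) {a : ι} {y : α}
    (hy : ExceedsExcept v a Q y) : ∀ x ∈ Q, v a y ≤ v a x := by
  obtain ⟨i, hi⟩ := hQ y
  by_cases hia : i = a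
  · exact hia ▸ hi
  · obtain ⟨x, hx, hlt⟩ := hy i hia
    exact absurd (hi x hx) hlt.not_ge

theorem IsDominant.exists_eq_of_forall_le (hv : ∀ i, Function.Injective (v i))
    (hP : IsDominant v P) (hQP : Q ⊆ P) {m : ι → α} (hm : ∀ i, m i ∈ Q ∧ ∀ x ∈ Q, v i (m i) ≤ v i x)
    {x : α} (hx : x ∈ Q) : ∃ i, m i = x ∧ ∀ z ∈ P, v i x ≤ v i z := by
  obtain ⟨i, hi⟩ := hP x
  exact ⟨i, hv i (((hm i).2 x hx).antisymm (hi _ (hQP (hm i).1))), hi⟩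

variable [DecidableEq α]

theorem IsDominant.existsUnique_insert [Finite α] (hv : ∀ i, Function.Injective (v i))
    (hQ : IsDominant v Q) {a : ι} (hex : ∃ y, ExceedsExcept v a Q y) :
    ∃! z, IsDominant v (insert z Q) ∧ ExceedsExcept v a Q z := by
  classical
  have := Fintype.ofFinite α
  obtain ⟨z, hz, hmax⟩ := exists_max_image {y | ExceedsExcept v a Q y} (v a)
    (hex.imp fun y hy => (mem_filter_univ y).2 hy)
  simp only [mem_filter_univ] at hz hmax
  refine ⟨z, ⟨fun y => ?_, hz⟩, fun w hw => ?_⟩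
  · by_cases hy : ExceedsExcept v a Q y
    · exact ⟨a, forall_mem_insert _ _ _ |>.2 ⟨hmax y hy, hQ.le_of_exceedsExcept hy⟩⟩
    · simp only [ExceedsExcept, not_forall, not_exists, not_and, not_lt] at hy
      obtain ⟨i, hia, hi⟩ := hy
      obtain ⟨x, hx, hxz⟩ := hz i hia
      exact ⟨i, forall_mem_insert _ _ _ |>.2 ⟨(hi x hx).trans hxz.le, hi⟩⟩
  · have hzw : v a z ≤ v a w :=
      hw.1.le_of_exceedsExcept
        (fun i hi => (hz i hi).imp fun x hx => ⟨mem_insert_of_mem hx.1, hx.2⟩) w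
        (mem_insert_self w Q)
    exact hv a ((hmax w hw.2).antisymm hzw)

variable [Fintype ι]

theorem IsDominant.image_eq_of_forall_le (hv : ∀ i, Function.Injective (v i))
    (hQ : IsDominant v Q) {m : ι → α} (hm : ∀ i, m i ∈ Q ∧ ∀ x ∈ Q, v i (m i) ≤ v i x) :
    univ.image m = Q := by
  refine (image_subset_iff.2 fun i _ => (hm i).1).antisymm fun x hx => ?_
  obtain ⟨i, hi, -⟩ := hQ.exists_eq_of_forall_le hv subset_rfl hm hx
  exact mem_image.2 ⟨i, mem_univ i, hi⟩

theorem IsDominant.exists_exceedsExcept_of_insert [DecidableEq ι]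
    (hv : ∀ i, Function.Injective (v i)) (hcard : #Q + 1 = Fintype.card ι) {m : ι → α}
    (hm : ∀ i, m i ∈ Q ∧ ∀ x ∈ Q, v i (m i) ≤ v i x) {z : α} (hzQ : z ∉ Q)
    (hz : IsDominant v (insert z Q)) :
    ∃ a, (univ.erase a).image m = Q ∧ ExceedsExcept v a Q z := by
  obtain ⟨a, ha⟩ := hz z
  let I : Finset ι := {i | v i (m i) < v i z}
  have hIQ : Q ⊆ I.image m := by
    intro x hx
    obtain ⟨i, rfl, hi⟩ := hz.exists_eq_of_forall_le hv (subset_insert z Q) hm hx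
    have hlt : v i (m i) < v i z := (hi z (mem_insert_self z Q)).lt_of_ne
      fun h => hzQ (hv i h ▸ hx)
    exact mem_image_of_mem m (by simpa only [I, mem_filter_univ] using hlt)
  have hIa : I = univ.erase a := by
    refine eq_of_subset_of_card_le (subset_erase.2 ⟨subset_univ I, ?_⟩) ?_
    · simpa only [I, mem_filter_univ, not_lt] using
        ha _ (mem_insert_of_mem (hm a).1)
    · have := (card_le_card hIQ).trans card_image_le
      rw [card_erase_of_mem (mem_univ a), card_univ]
      omega
  refine ⟨a, (image_subset_iff.2 fun i _ => (hm i).1).antisymm (hIa ▸ hIQ), fun i hi => ?_⟩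
  have hiI : i ∈ I := hIa ▸ mem_erase.2 ⟨hi, mem_univ i⟩
  exact ⟨m i, (hm i).1, by simpa only [I, mem_filter_univ] using hiI⟩

theorem IsSlack.isDominant_image_erase [DecidableEq ι] (he : IsSlack v e) (i₀ : ι) :
    IsDominant v ((univ.erase i₀).image e) := by
  intro y
  by_cases hy : y ∈ Set.range e
  · obtain ⟨i, rfl⟩ := hy
    exact ⟨i, fun x _ => he.le i x⟩
  · exact ⟨i₀, forall_mem_image.2 fun j hj => (he.lt i₀ j y (ne_of_mem_erase hj) hy).le⟩

theorem IsSlack.exceedsExcept_image_erase_iff [DecidableEq ι]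
    (hv : ∀ i, Function.Injective (v i)) (he : IsSlack v e) {i₀ : ι} {z : α} :
    ExceedsExcept v i₀ ((univ.erase i₀).image e) z ↔ z ∉ (univ.erase i₀).image e := by
  constructor
  · rintro h hz
    obtain ⟨i, hi, rfl⟩ := mem_image.1 hz
    obtain ⟨x, -, hx⟩ := h i (ne_of_mem_erase hi)
    exact hx.not_ge (he.le i x)
  · intro hz i hi
    have hei : e i ∈ (univ.erase i₀).image e :=
      mem_image_of_mem e (mem_erase.2 ⟨hi, mem_univ i⟩)
    exact ⟨e i, hei, (he.le i z).lt_of_ne fun h => hz (hv i h ▸ hei)⟩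

variable [Fintype α]

instance : DecidablePred (IsDominant v) := fun P =>
  inferInstanceAs (Decidable (∀ y, ∃ i, ∀ x ∈ P, v i y ≤ v i x))

theorem IsDominant.card_filter_insert_eq_two (hv : ∀ i, Function.Injective (v i))
    (hQ : IsDominant v Q) (hne : Q.Nonempty) (hcard : #Q + 1 = Fintype.card ι)
    (hex : ∀ a, ∃ y, ExceedsExcept v a Q y) :
    #{z ∈ Qᶜ | IsDominant v (insert z Q)} = 2 := by
  classical
  choose m hm using fun i => exists_min_image Q (v i) hne
  have himage := hQ.image_eq_of_forall_le hv hm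
  -- Exactly two orders share their least point of `Q`, and each of them provides one extension.
  have hpair : #{a | (univ.erase a).image m = Q} = 2 := by
    simpa only [himage] using card_filter_image_erase_eq_image univ m
      (by rw [himage, card_univ, hcard])
  choose z hz hunique using fun a => hQ.existsUnique_insert hv (hex a)
  rw [← hpair]
  symm
  refine card_bij (fun a _ => z a) (fun a ha => ?_) (fun a _ b _ hab => ?_) fun w hw => ?_
  · refine mem_filter.2 ⟨mem_compl.2 fun hzQ => ?_, (hz a).1⟩
    rw [← (mem_filter_univ a).1 ha] at hzQ
    obtain ⟨i, hi, hiz⟩ := mem_image.1 hzQ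
    obtain ⟨x, hx, hlt⟩ := (hz a).2 i (ne_of_mem_erase hi)
    exact ((hm i).2 x hx).not_gt (hiz ▸ hlt)
  · by_contra hne
    obtain ⟨i, hi⟩ := hQ (z a)
    obtain ⟨x, hx, hlt⟩ : ∃ x ∈ Q, v i x < v i (z a) := by
      by_cases hia : i = a
      · exact hab ▸ (hz b).2 i (hia ▸ hne)
      · exact (hz a).2 i hia
    exact (hi x hx).not_gt hlt
  · obtain ⟨hwQ, hw⟩ := mem_filter.1 hw
    obtain ⟨a, ha, hwa⟩ :=
      hw.exists_exceedsExcept_of_insert hv hcard hm (mem_compl.1 hwQ)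
    exact ⟨a, (mem_filter_univ a).2 ha, (hunique a w ⟨hw, hwa⟩).symm⟩

/-- The rooms of Scarf's parity argument: dominant sets with as many points as there are orders. -/
def rooms (v : ι → α → β) : Finset (Finset α) :=
  {P | IsDominant v P ∧ #P = Fintype.card ι}

theorem card_rooms_filter_covBy [DecidablePred (Q ⋖ ·)] (hQ : #Q + 1 = Fintype.card ι) :
    #{P ∈ rooms v | Q ⋖ P} = #{z ∈ Qᶜ | IsDominant v (insert z Q)} := by
  rw [← card_filter_covBy_left]
  congr 1
  ext P
  simp only [rooms, mem_filter, mem_univ, true_and]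
  refine ⟨fun h => ⟨h.2, h.1.1⟩, fun h => ⟨⟨h.2, ?_⟩, h.1⟩⟩
  rw [← Order.covBy_iff_add_one_eq.1 h.1.card_finset, hQ]

variable [DecidableEq ι]

/-- The doors of Scarf's parity argument: dominant sets with one point less than a room, carrying
each colour but `i₀` exactly once. -/
def doors (v : ι → α → β) (c : α → ι) (i₀ : ι) : Finset (Finset α) :=
  {Q | IsDominant v Q ∧ #Q + 1 = Fintype.card ι ∧ Q.image c = univ.erase i₀}

theorem even_card_doors_filter_covBy (c : α → ι) (i₀ : ι) [DecidablePred (· ⋖ P)]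
    (hP : P ∈ rooms v) (hc : P.image c ≠ univ) : Even #{Q ∈ doors v c i₀ | Q ⋖ P} := by
  obtain ⟨hdom, hcard⟩ := (mem_filter_univ P).1 hP
  have hdoors : {Q ∈ doors v c i₀ | Q ⋖ P} =
      ({Q | Q ⋖ P ∧ Q.image c = univ.erase i₀} : Finset (Finset α)) := by
    ext Q
    simp only [doors, mem_filter, mem_univ, true_and]
    refine ⟨fun h => ⟨h.2, h.1.2.2⟩, fun h => ⟨⟨hdom.anti h.1.le, ?_, h.2⟩, h.1⟩⟩
    rw [Order.covBy_iff_add_one_eq.1 h.1.card_finset, hcard]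
  rw [hdoors, card_filter_covBy_right]
  exact even_card_filter_image_erase c i₀ hcard hc

theorem IsSlack.card_filter_insert_eq_one (hv : ∀ i, Function.Injective (v i))
    (he : IsSlack v e) (hinj : Function.Injective e) (i₀ : ι) :
    #{z ∈ ((univ.erase i₀).image e)ᶜ |
      IsDominant v (insert z ((univ.erase i₀).image e))} = 1 := by
  have hi₀ : e i₀ ∉ (univ.erase i₀).image e := fun h =>
    notMem_erase i₀ univ ((hinj.mem_finset_image).1 h)
  rw [card_eq_one_iff_existsUnique]
  simpa only [mem_filter, mem_compl, and_comm, he.exceedsExcept_image_erase_iff hv] using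
    (he.isDominant_image_erase i₀).existsUnique_insert hv
      ⟨e i₀, (he.exceedsExcept_image_erase_iff hv).2 hi₀⟩

theorem IsSlack.image_erase_mem_doors (he : IsSlack v e) (hc : Function.LeftInverse c e)
    (i₀ : ι) : (univ.erase i₀).image e ∈ doors v c i₀ := by
  refine (mem_filter_univ _).2 ⟨he.isDominant_image_erase i₀, ?_, ?_⟩
  · rw [card_image_of_injective _ hc.injective, card_erase_add_one (mem_univ i₀), card_univ]
  · rw [image_image, hc.comp_eq_id, image_id]

theorem IsSlack.card_rooms_filter_covBy_eq_two (hv : ∀ i, Function.Injective (v i))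
    (he : IsSlack v e) (hc : Function.LeftInverse c e) {i₀ : ι} [DecidablePred (Q ⋖ ·)]
    (hQ : Q ∈ doors v c i₀) (hne : Q ≠ (univ.erase i₀).image e) :
    #{P ∈ rooms v | Q ⋖ P} = 2 := by
  obtain ⟨hdom, hcard, himage⟩ := (mem_filter_univ Q).1 hQ
  obtain ⟨y, hyQ, hy⟩ : ∃ y ∈ Q, y ∉ Set.range e := by
    by_contra! hrange
    refine hne ?_
    rw [← himage, image_image, image_congr (g := id), image_id]
    intro x hx
    obtain ⟨i, rfl⟩ := hrange x hx
    exact congrArg e (hc i)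
  rw [card_rooms_filter_covBy hcard]
  exact hdom.card_filter_insert_eq_two hv ⟨y, hyQ⟩ hcard fun a =>
    ⟨e a, fun i hi => ⟨y, hyQ, he.lt i a y hi.symm hy⟩⟩

end Scarf

section ScarfLemma

open Finset

variable {ι α β : Type*}

/-- Scarf's lemma. The pairs of a door and a room containing it are counted in two ways. -/
theorem IsSlack.exists_isDominant_forall_exists_mem [LinearOrder β] [Finite ι] [Nonempty ι]
    [Finite α] {v : ι → α → β} (hv : ∀ i, Function.Injective (v i)) {e : ι → α} (he : IsSlack v e)
    {c : α → ι} (hc : Function.LeftInverse c e) :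
    ∃ P, IsDominant v P ∧ ∀ i, ∃ x ∈ P, c x = i := by
  classical
  have := Fintype.ofFinite ι
  have := Fintype.ofFinite α
  by_contra! hmissing
  have hcolour : ∀ P, IsDominant v P → P.image c ≠ univ := by
    intro P hP himage
    obtain ⟨i, hi⟩ := hmissing P hP
    obtain ⟨x, hx, rfl⟩ := mem_image.1 (himage ▸ mem_univ i)
    exact hi x hx rfl
  obtain ⟨i₀⟩ := ‹Nonempty ι›
  let Q₀ := (univ.erase i₀).image e
  have hQ₀ : Q₀ ∈ doors v c i₀ := he.image_erase_mem_doors hc i₀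
  have hcount := sum_card_bipartiteAbove_eq_sum_card_bipartiteBelow (s := doors v c i₀)
    (t := rooms v) (· ⋖ ·)
  have heven : Even (∑ P ∈ rooms v, #{Q ∈ doors v c i₀ | Q ⋖ P}) :=
    even_sum _ fun P hP =>
      even_card_doors_filter_covBy c i₀ hP (hcolour P ((mem_filter_univ P).1 hP).1)
  have hodd : Odd (∑ Q ∈ doors v c i₀, #{P ∈ rooms v | Q ⋖ P}) := by
    rw [← add_sum_erase _ _ hQ₀, card_rooms_filter_covBy ((mem_filter_univ Q₀).1 hQ₀).2.1,
      he.card_filter_insert_eq_one hv hc.injective]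
    refine odd_one.add_even (even_sum _ fun Q hQ => ?_)
    rw [he.card_rooms_filter_covBy_eq_two hv hc (mem_of_mem_erase hQ) (ne_of_mem_erase hQ)]
    exact even_two
  exact Nat.not_even_iff_odd.2 hodd (hcount ▸ heven)

/-- The coordinates on `α` extended to slack points indexed by `ι`. The `i`-th coordinate is least
at the `i`-th slack point and greatest at all other slack points. -/
def slackExtend [DecidableEq ι] (v : ι → α → β) (i : ι) : α ⊕ ι → WithBot (WithTop β) :=
  Sum.elim (fun x => ((v i x : WithTop β) : WithBot (WithTop β))) fun j => if j = i then ⊥ else ⊤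

theorem isSlack_slackExtend [DecidableEq ι] [LinearOrder β] {γ : Type*} [LinearOrder γ]
    (v : ι → α → β) (t : α ⊕ ι → γ) :
    IsSlack (fun i z => toLex (slackExtend v i z, t z)) Sum.inr where
  le i z := by
    by_cases hz : z = Sum.inr i
    · rw [hz]
    · refine (Prod.Lex.toLex_lt_toLex.2 (Or.inl ?_)).le
      rcases z with x | j
      · simp [slackExtend]
      · simp [slackExtend, show j ≠ i from fun h => hz (h ▸ rfl)]
  lt i j z hji hz := by
    rcases z with x | k
    · exact Prod.Lex.toLex_lt_toLex.2 (Or.inl (by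
        simpa [slackExtend, hji] using WithBot.coe_lt_coe.2 (WithTop.coe_lt_top (v i x))))
    · exact absurd ⟨k, rfl⟩ hz

theorem exists_finset_forall_exists_mem_forall_le [LinearOrder β] [Finite ι] [Finite α]
    (v : ι → α → β) (c : α → ι) : ∃ s : Finset α, ∀ y, ∃ z ∈ s, ∀ x ∈ s, v (c z) y ≤ v (c z) x := by
  classical
  rcases isEmpty_or_nonempty α with _ | ⟨⟨a⟩⟩
  · exact ⟨∅, isEmptyElim⟩
  have : Nonempty ι := ⟨c a⟩
  obtain ⟨t, ht⟩ := Countable.exists_injective_nat (α ⊕ ι)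
  have hslack := isSlack_slackExtend v t
  obtain ⟨P, hP, hcolour⟩ := hslack.exists_isDominant_forall_exists_mem
    (fun i x y hxy => ht (congrArg (fun z => (ofLex z).2) hxy))
    (c := Sum.elim c id) fun _ => rfl
  refine ⟨P.toLeft, fun y => ?_⟩
  obtain ⟨i, hi⟩ := hP (Sum.inl y)
  have hle : ∀ z ∈ P, slackExtend v i (Sum.inl y) ≤ slackExtend v i z := fun z hz =>
    Prod.Lex.monotone_fst _ _ (hi z hz)
  obtain ⟨z | j, hz, rfl⟩ := hcolour i
  · exact ⟨z, mem_toLeft.2 hz, fun x hx => by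
      simpa [slackExtend] using hle _ (mem_toLeft.1 hx)⟩
  · simpa [slackExtend] using hle _ hz

end ScarfLemma

section Brouwer

variable {ι : Type*} [Fintype ι]

theorem stdSimplex_apply_le_add_dist (x y : stdSimplex ℝ ι) (i : ι) : x i ≤ y i + dist x y :=
  sub_le_iff_le_add'.1 ((le_abs_self _).trans (dist_le_pi_dist x.1 y.1 i))

variable [Nonempty ι]

theorem exists_stdSimplex_forall_lt {w : ι → ℝ} (hw : ∀ i, 0 ≤ w i) (hsum : ∑ i, w i < 1) :
    ∃ y : stdSimplex ℝ ι, ∀ i, w i < y i := by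
  have hgap : 0 < (1 - ∑ i, w i) / Fintype.card ι :=
    div_pos (sub_pos.2 hsum) (Nat.cast_pos.2 Fintype.card_pos)
  refine ⟨⟨fun i => w i + (1 - ∑ j, w j) / Fintype.card ι,
    fun i => add_nonneg (hw i) hgap.le, ?_⟩, fun i => lt_add_of_pos_right _ hgap⟩
  rw [Finset.sum_add_distrib, Finset.sum_const, Finset.card_univ, nsmul_eq_mul,
    mul_div_cancel₀ _ (Nat.cast_ne_zero.2 Fintype.card_ne_zero), add_sub_cancel]

theorem exists_le_and_le_add_of_forall_stdSimplex {σ : Finset (stdSimplex ℝ ι)} (hσ : σ.Nonempty)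
    {C : Finset ι} {δ : ℝ} (hδ : 0 ≤ δ)
    (hdom : ∀ y : stdSimplex ℝ ι, ∃ i ∈ C, ∀ x ∈ σ, y i ≤ x i + δ) :
    ∃ u : ι → ℝ, (∀ i ∉ C, u i = 0) ∧
      ∀ x ∈ σ, ∀ i, u i ≤ x i ∧ x i ≤ u i + Fintype.card ι * δ := by
  classical
  choose m hmσ hmin using fun i => σ.exists_min_image (fun x => x i) hσ
  let u : ι → ℝ := fun i => if i ∈ C then m i i else 0
  have hule : ∀ x ∈ σ, ∀ i, u i ≤ x i := by
    intro x hx i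
    by_cases hi : i ∈ C
    · simpa only [u, if_pos hi] using hmin i x hx
    · simpa only [u, if_neg hi] using stdSimplex.zero_le x i
  have hnonneg : ∀ i, 0 ≤ u i := fun i => by
    by_cases hi : i ∈ C
    · simpa only [u, if_pos hi] using stdSimplex.zero_le (m i) i
    · simp only [u, if_neg hi, le_refl]
  have hone : 1 ≤ ∑ i, u i + Fintype.card ι * δ := by
    rw [← nsmul_eq_mul, ← Finset.card_univ, ← Finset.sum_const, ← Finset.sum_add_distrib]
    by_contra! hlt
    obtain ⟨y, hy⟩ := exists_stdSimplex_forall_lt (fun i => add_nonneg (hnonneg i) hδ) hlt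
    obtain ⟨i, hi, hyi⟩ := hdom y
    exact (hy i).not_ge (by simpa only [u, if_pos hi] using hyi (m i) (hmσ i))
  refine ⟨u, fun i hi => if_neg hi, fun x hx i => ⟨hule x hx i, ?_⟩⟩
  have hle := Finset.single_le_sum (fun j _ => sub_nonneg.2 (hule x hx j)) (Finset.mem_univ i)
  rw [Finset.sum_sub_distrib, stdSimplex.sum_eq_one x] at hle
  linarith

theorem exists_finset_dist_le_of_coloring (c : stdSimplex ℝ ι → ι) {ε : ℝ} (hε : 0 < ε) :
    ∃ σ : Finset (stdSimplex ℝ ι), σ.Nonempty ∧ (∀ x ∈ σ, ∀ y ∈ σ, dist x y ≤ ε) ∧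
      ∀ i, (∃ x ∈ σ, c x = i) ∨ ∀ x ∈ σ, x i ≤ ε := by
  classical
  have hn : (0 : ℝ) < Fintype.card ι := Nat.cast_pos.2 Fintype.card_pos
  obtain ⟨E, -, hE, hcover⟩ :=
    Metric.finite_approx_of_totallyBounded (isCompact_univ (X := stdSimplex ℝ ι)).totallyBounded
      (ε / Fintype.card ι) (div_pos hε hn)
  have := hE.to_subtype
  obtain ⟨s, hs⟩ := exists_finset_forall_exists_mem_forall_le
    (fun i (x : E) => (x : stdSimplex ℝ ι) i) fun x => c x
  let σ : Finset (stdSimplex ℝ ι) := s.map (Function.Embedding.subtype _)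
  have hdom : ∀ y : stdSimplex ℝ ι,
      ∃ i ∈ σ.image c, ∀ x ∈ σ, y i ≤ x i + ε / Fintype.card ι := by
    intro y
    obtain ⟨e, he, hye⟩ := Set.mem_iUnion₂.1 (hcover (Set.mem_univ y))
    obtain ⟨z, hz, hle⟩ := hs ⟨e, he⟩
    refine ⟨c z, Finset.mem_image_of_mem c (Finset.mem_map_of_mem _ hz), fun x hx => ?_⟩
    obtain ⟨x, hxs, rfl⟩ := Finset.mem_map.1 hx
    exact (stdSimplex_apply_le_add_dist y e (c z)).trans
      (add_le_add (hle x hxs) (Metric.mem_ball.1 hye).le)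
  have hσ : σ.Nonempty := by
    obtain ⟨i, hi, -⟩ := hdom (Classical.arbitrary _)
    exact Finset.image_nonempty.1 ⟨i, hi⟩
  obtain ⟨u, hu0, hu⟩ := exists_le_and_le_add_of_forall_stdSimplex hσ (div_pos hε hn).le hdom
  simp only [mul_div_cancel₀ ε hn.ne'] at hu
  refine ⟨σ, hσ, fun x hx y hy => ?_, fun i => ?_⟩
  · refine (dist_pi_le_iff hε.le).2 fun i => ?_
    obtain ⟨hux, hxu⟩ := hu x hx i
    obtain ⟨huy, hyu⟩ := hu y hy i
    exact abs_sub_le_iff.2 ⟨sub_le_iff_le_add'.2 (hxu.trans (add_le_add_left huy ε)),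
      sub_le_iff_le_add'.2 (hyu.trans (add_le_add_left hux ε))⟩
  · by_cases hi : i ∈ σ.image c
    · exact Or.inl (Finset.mem_image.1 hi)
    · exact Or.inr fun x hx => by simpa only [hu0 i hi, zero_add] using (hu x hx i).2

theorem exists_forall_exists_dist_le_and_le_add (g : stdSimplex ℝ ι → stdSimplex ℝ ι) {ε : ℝ}
    (hε : 0 < ε) : ∃ x : stdSimplex ℝ ι, ∀ i, ∃ z, dist z x ≤ ε ∧ x i ≤ g z i + ε := by
  have hnondecr : ∀ z : stdSimplex ℝ ι, ∃ i, z i ≤ g z i := fun z => by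
    obtain ⟨i, -, hi⟩ := Finset.exists_le_of_sum_le Finset.univ_nonempty
      ((stdSimplex.sum_eq_one z).trans (stdSimplex.sum_eq_one (g z)).symm).le
    exact ⟨i, hi⟩
  choose c hc using hnondecr
  obtain ⟨σ, ⟨x, hx⟩, hdist, hcolour⟩ := exists_finset_dist_le_of_coloring c hε
  refine ⟨x, fun i => ?_⟩
  rcases hcolour i with ⟨z, hz, rfl⟩ | hsmall
  · exact ⟨z, hdist z hz x hx, (stdSimplex_apply_le_add_dist x z (c z)).trans
      (add_le_add (hc z) (hdist x hx z hz))⟩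
  · exact ⟨x, (dist_self x).trans_le hε.le,
      (hsmall x hx).trans (le_add_of_nonneg_left (stdSimplex.zero_le (g x) i))⟩

theorem exists_isFixedPt_stdSimplex {g : stdSimplex ℝ ι → stdSimplex ℝ ι} (hg : Continuous g) :
    ∃ x, Function.IsFixedPt g x := by
  choose x z hdist hle using fun n : ℕ =>
    exists_forall_exists_dist_le_and_le_add g (Nat.one_div_pos_of_nat (α := ℝ) (n := n))
  obtain ⟨a, φ, hφ, hx⟩ := CompactSpace.tendsto_subseq x
  have hφε := tendsto_one_div_add_atTop_nhds_zero_nat (𝕜 := ℝ).comp hφ.tendsto_atTop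
  have hle_lim : ∀ i, a i ≤ g a i := by
    intro i
    have hz : Tendsto (fun n => z (φ n) i) atTop (𝓝 a) :=
      (tendsto_iff_of_dist (squeeze_zero (fun _ => dist_nonneg)
        (fun n => hdist (φ n) i) hφε)).2 hx
    have hcoord : Continuous fun y : stdSimplex ℝ ι => y i :=
      (continuous_apply i).comp continuous_subtype_val
    have hgz : Tendsto (fun n => g (z (φ n) i) i + 1 / ((φ n : ℝ) + 1)) atTop (𝓝 (g a i + 0)) :=
      (((hcoord.comp hg).tendsto a).comp hz).add hφε
    rw [add_zero] at hgz
    exact le_of_tendsto_of_tendsto' ((hcoord.tendsto a).comp hx) hgz fun n => hle (φ n) i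
  refine ⟨a, stdSimplex.ext (funext fun i => ?_)⟩
  exact ((Finset.sum_eq_sum_iff_of_le fun i _ => hle_lim i).1
    ((stdSimplex.sum_eq_one a).trans (stdSimplex.sum_eq_one (g a)).symm) i (Finset.mem_univ i)).symm

end Brouwer

section Schauder

variable {X : Type*} [AddCommGroup X] [Module ℝ X]

theorem exists_continuous_stdSimplex_seminorm_sub_sum_lt {T κ : Type*} [TopologicalSpace T]
    [Fintype κ] {p : Seminorm ℝ X} {y : T → X} {c : κ → X} {ε : ℝ}
    (hcont : ∀ j, Continuous fun t => p (y t - c j)) (hcover : ∀ t, ∃ j, p (y t - c j) < ε) :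
    ∃ w : T → stdSimplex ℝ κ, Continuous w ∧ ∀ t, p (∑ j, w t j • c j - y t) < ε := by
  let φ : κ → T → ℝ := fun j t => max (ε - p (y t - c j)) 0
  have hφ : ∀ j, Continuous (φ j) := fun j => (continuous_const.sub (hcont j)).max continuous_const
  have hφ0 : ∀ j t, 0 ≤ φ j t := fun j t => le_max_right _ _
  have hsum : ∀ t, 0 < ∑ j, φ j t := by
    intro t
    obtain ⟨j, hj⟩ := hcover t
    exact Finset.sum_pos' (fun j _ => hφ0 j t)
      ⟨j, Finset.mem_univ j, lt_max_of_lt_left (sub_pos.2 hj)⟩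
  let w : T → stdSimplex ℝ κ := fun t =>
    ⟨fun j => φ j t / ∑ i, φ i t, fun j => div_nonneg (hφ0 j t) (hsum t).le, by
      rw [← Finset.sum_div, div_self (hsum t).ne']⟩
  refine ⟨w, Continuous.subtype_mk (continuous_pi fun j => ?_) _, fun t => ?_⟩
  · exact (hφ j).div (continuous_finsetSum _ fun i _ => hφ i) fun t => (hsum t).ne'
  · have hmem : ∀ j, w t j ≠ 0 → c j ∈ p.ball (y t) ε := by
      intro j hj
      have hφj : φ j t ≠ 0 := fun h => hj (by simp [w, DFunLike.coe, h])
      rw [Seminorm.mem_ball, map_sub_rev, ← sub_pos]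
      exact (lt_max_iff.1 ((hφ0 j t).lt_of_ne' hφj)).resolve_right (lt_irrefl 0)
    have hball := (p.convex_ball (y t) ε).finsum_mem (w t).2.1
      ((finsum_eq_sum_of_fintype _).trans (w t).2.2) hmem
    rw [finsum_eq_sum_of_fintype] at hball
    exact p.mem_ball.1 hball

theorem exists_seminorm_sub_lt_of_finite_cover [TopologicalSpace X] [IsTopologicalAddGroup X]
    [ContinuousSMul ℝ X] {C : Set X} (hconv : Convex ℝ C) {f : C → X} (hf : SeqContinuous f)
    {p : Seminorm ℝ X} (hp : Continuous p) {κ : Type*} [Finite κ] [Nonempty κ] (c : κ → C) {ε : ℝ}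
    (hcover : ∀ x, ∃ j, p (f x - c j) < ε) : ∃ x : C, p (x - f x) < ε := by
  have := Fintype.ofFinite κ
  let h : stdSimplex ℝ κ → C := fun t =>
    ⟨∑ j, t j • (c j : X), hconv.sum_mem (fun j _ => t.2.1 j) t.2.2 fun j _ => (c j).2⟩
  have hh : Continuous h := Continuous.subtype_mk (continuous_finsetSum _ fun j _ =>
    ((continuous_apply j).comp continuous_subtype_val).smul continuous_const) _
  have hseq : SeqContinuous (f ∘ h) := fun _ _ hu => hf (hh.seqContinuous hu)
  obtain ⟨w, hw, hclose⟩ := exists_continuous_stdSimplex_seminorm_sub_sum_lt (y := f ∘ h)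
    (c := fun j => (c j : X))
    (fun j => hp.comp (hseq.continuous.sub continuous_const)) fun t => hcover (h t)
  obtain ⟨t, ht⟩ := exists_isFixedPt_stdSimplex hw
  have hlt := hclose t
  rw [ht.eq] at hlt
  exact ⟨h t, hlt⟩

theorem exists_seminorm_sub_lt_of_totallyBounded [UniformSpace X] [IsUniformAddGroup X]
    [ContinuousSMul ℝ X] {C : Set X} (hne : C.Nonempty) (hconv : Convex ℝ C) {f : C → X}
    (hf : SeqContinuous f) (hfC : ∀ x, f x ∈ closure C) (htb : TotallyBounded (Set.range f))
    {p : Seminorm ℝ X} (hp : Continuous p) {ε : ℝ} (hε : 0 < ε) : ∃ x : C, p (x - f x) < ε := by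
  have hent : {q : X × X | p (q.1 - q.2) < ε / 2} ∈ uniformity X := by
    rw [uniformity_eq_comap_nhds_zero_swapped]
    exact ⟨p ⁻¹' Set.Iio (ε / 2), (isOpen_Iio.preimage hp).mem_nhds (by simpa using hε), subset_rfl⟩
  obtain ⟨s, hs, hsfin, hcover⟩ := htb.exists_subset hent
  have hnear : ∀ y : s, ∃ c : C, p (y - c) < ε / 2 := by
    rintro ⟨_, hy⟩
    obtain ⟨x, rfl⟩ := hs hy
    have hopen : IsOpen {z | p (f x - z) < ε / 2} :=
      isOpen_Iio.preimage (hp.comp (continuous_const.sub continuous_id))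
    obtain ⟨c, hc, hcC⟩ := mem_closure_iff.1 (hfC x) _ hopen (by simpa using hε)
    exact ⟨⟨c, hcC⟩, hc⟩
  choose c hc using hnear
  have hcover' : ∀ x, ∃ y : s, p (f x - c y) < ε := by
    intro x
    obtain ⟨y, hy, hxy⟩ := Set.mem_iUnion₂.1 (hcover ⟨x, rfl⟩)
    refine ⟨⟨y, hy⟩, ?_⟩
    calc p (f x - c ⟨y, hy⟩) ≤ p (f x - y) + p (y - c ⟨y, hy⟩) := le_map_sub_add_map_sub p _ _ _
      _ < ε / 2 + ε / 2 := add_lt_add hxy (hc ⟨y, hy⟩)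
      _ = ε := add_halves ε
  have := hsfin.to_subtype
  have : Nonempty s := ⟨(hcover' ⟨_, hne.some_mem⟩).choose⟩
  exact exists_seminorm_sub_lt_of_finite_cover hconv hf hp c hcover'

theorem exists_continuous_seminorm_ball_subset [TopologicalSpace X] [IsTopologicalAddGroup X]
    [ContinuousSMul ℝ X] [LocallyConvexSpace ℝ X] {U : Set X} (hU : U ∈ 𝓝 0) :
    ∃ p : Seminorm ℝ X, Continuous p ∧ p.ball 0 1 ⊆ U := by
  obtain ⟨V, hV, hVU⟩ := (nhds_hasBasis_absConvex_open ℝ X).mem_iff.1 hU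
  let V' : AbsConvexOpenSets ℝ X := ⟨V, hV⟩
  refine ⟨gaugeSeminormFamily ℝ X V',
    (with_gaugeSeminormFamily (𝕜 := ℝ) (E := X)).continuous_seminorm V', ?_⟩
  rwa [gaugeSeminormFamily_ball]

end Schauder

section Net

variable {X : Type u} [AddCommGroup X] [TopologicalSpace X] {C : Set X}

theorem hasApproxFixedPointNet_iff {f : C → closure C} :
    HasApproxFixedPointNet f ↔ (0 : X) ∈ closure {y : X | ∃ x : C, y = (x : X) - (f x : X)} := by
  constructor
  · rintro ⟨ι, _, _, _, x, hx⟩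
    exact mem_closure_of_tendsto hx (.of_forall fun i => ⟨x i, rfl⟩)
  · intro h
    have hnhds : ∀ U : TopologicalSpace.OpenNhdsOf (0 : X), ∃ x : C, (x : X) - f x ∈ U := by
      intro U
      obtain ⟨_, hU, x, rfl⟩ := mem_closure_iff.1 h U U.isOpen U.mem
      exact ⟨x, hU⟩
    choose x hx using hnhds
    refine ⟨(TopologicalSpace.OpenNhdsOf (0 : X))ᵒᵈ, inferInstance, inferInstance, inferInstance,
      fun U => x U.ofDual, ?_⟩
    refine (TopologicalSpace.OpenNhdsOf.basis_nhds (x := (0 : X))).tendsto_right_iff.2 fun U _ => ?_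
    filter_upwards [eventually_ge_atTop (OrderDual.toDual U)] with V hV
    exact hV (hx V.ofDual)

end Net

theorem theorem1 {X : Type u} [AddCommGroup X] [Module ℝ X]
    [UniformSpace X] [IsUniformAddGroup X] [ContinuousSMul ℝ X] [LocallyConvexSpace ℝ X]
    (C : Set X) (hne : C.Nonempty) (hconv : Convex ℝ C)
    (f : C → closure C) (hf : SeqContinuous f)
    (htb : TotallyBounded (Set.range fun x : C => (f x : X))) :
    HasApproxFixedPointNet f ∧
      (0 : X) ∈ closure {y : X | ∃ x : C, y = (x : X) - (f x : X)} := by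
  have hzero : (0 : X) ∈ closure {y : X | ∃ x : C, y = (x : X) - (f x : X)} := by
    refine mem_closure_iff_nhds.2 fun U hU => ?_
    obtain ⟨p, hp, hpU⟩ := exists_continuous_seminorm_ball_subset hU
    have hf' : SeqContinuous fun x => (f x : X) := fun _ _ hu =>
      (continuous_subtype_val.tendsto _).comp (hf hu)
    obtain ⟨x, hx⟩ := exists_seminorm_sub_lt_of_totallyBounded hne hconv hf' (fun x => (f x).2)
      htb hp one_pos
    exact ⟨_, hpU ((p.mem_ball_zero).2 hx), x, rfl⟩
  exact ⟨hasApproxFixedPointNet_iff.2 hzero, hzero⟩
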